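/- Let $E$ be a set with a partial binary operation. For $e,f\in E$ write $e\mathrel{\omega^l}f$ if $ef$ is defined and $ef=e$, and $e\mathrel{\omega^r}f$ if $fe$ is defined and $fe=e$; put $\omega=\omega^l\cap\omega^r$, $\mathcal L=\omega^l\cap(\omega^l)^{-1}$, $\mathcal R=\omega^r\cap(\omega^r)^{-1}$, $\omega^l(e)=\{g: g\mathrel{\omega^l}e\}$ and $\omega^r(e)=\{g: g\mathrel{\omega^r}e\}$. For $e,f\in E$ let $$M(e,f)=\omega^l(e)\cap\omega^r(f),\qquad S(e,f)=\{h\in M(e,f): g\preceq h\text{ for all }g\in M(e,f)\},$$ where $g\preceq h$ means that $eg\mathrel{\omega^r}eh$ and $gf\mathrel{\omega^l}hf$. The set $E$ is a *biordered set* if the following axioms and their left-right duals hold for all $e,f,g\in E$: - (B1) $\omega^l$ and $\omega^r$ are reflexive and transitive, and $ef$ is defined if and only if $(e,f)\in(\omega^r\cup\omega^l)\cup(\omega^r\cup\omega^l)^{-1}$; - (B21) if $f\in\omega^r(e)$, then $f\mathrel{\mathcal R}fe\mathrel{\omega}e$; - (B22) if $g\mathrel{\omega^l}f$ and $f,g\in\omega^r(e)$,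 then $ge\mathrel{\omega^l}fe$; - (B31) if $g\mathrel{\omega^r}f\mathrel{\omega^r}e$, then $gf=(ge)f$; - (B32) if $g\mathrel{\omega^l}f$ and $f,g\in\omega^r(e)$, then $(fg)e=(fe)(ge)$; - (B4) if $f,g\in\omega^r(e)$, then $S(f,g)e=S(fe,ge)$, where $S(f,g)e=\{he: h\in S(f,g)\}$. It is *regular* if $S(e,f)\neq\emptyset$ for all $e,f\in E$. Let $E$ be a regular biordered set such that - (E1) there is an element $0\in E$ with $0\mathrel{\omega}e$ for all $e\in E$; - (E2) there is a map $e\mapsto e'$ from $E$ to $E$ such that, for all $e,f\in E$: (i) $(e')'=e$; (ii) $f\mathrel{\omega^l}e$ if and only if $e'\mathrel{\omega^r}f'$; (iii) $f\mathrel{\omega^l}e'$ if and only if $M(f,e)=\{0\}$. Then $\mathcal L$ and $\mathcal R$ are equivalence relations, and the quotients $E/\mathcal L$ and $E/\mathcal R$, partially ordered by $\mathcal L(e)\le\mathcal L(f)\iff e\mathrel{\omega^l}f$ and $\mathcal R(e)\le\mathcal R(f)\iff e\mathrel{\omega^r}f$ respectively, are complemented modular lattices (lattices with least and greatest element that are modular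 and in which every element has a complement). Moreover, $E/\mathcal L$ and $E/\mathcal R$ are dually isomorphic: there is an order-reversing bijection $E/\mathcal L\to E/\mathcal R$ whose inverse is also order-reversing. -/

import Mathlib

namespace Biorder

/-- A set with a partial binary operation: `pmul e f = some g` says that the product `ef` is
defined and equals `g`, and `pmul e f = none` says that `ef` is not defined. -/
class PartialMagma (E : Type*) where
  /-- the partial product -/
  pmul : E → E → Option E

section Basic

variable {E : Type*} [PartialMagma E]

/-- The partial product `ef`. -/
def pmul (e f : E) : Option E := PartialMagma.pmul e f

/-- `e ω^l f`: the product `ef` is defined and `ef = e`. -/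
def OmL (e f : E) : Prop := pmul e f = some e

/-- `e ω^r f`: the product `fe` is defined and `fe = e`. -/
def OmR (e f : E) : Prop := pmul f e = some e

/-- `ω = ω^l ∩ ω^r`. -/
def Om (e f : E) : Prop := OmL e f ∧ OmR e f

/-- `L = ω^l ∩ (ω^l)⁻¹`. -/
def GreenL (e f : E) : Prop := OmL e f ∧ OmL f e

/-- `R = ω^r ∩ (ω^r)⁻¹`. -/
def GreenR (e f : E) : Prop := OmR e f ∧ OmR f e

/-- `M(e, f) = ω^l(e) ∩ ω^r(f)`. -/
def MSet (e f : E) : Set E := {g | OmL g e ∧ OmR g f}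

/-- The relation `g ⪯ h` attached to `e, f`: `eg ω^r eh` and `gf ω^l hf`.  For `g, h ∈ M(e, f)` in
a biordered set the four products are always defined. -/
def SandwichLE (e f g h : E) : Prop :=
  (∃ x y, pmul e g = some x ∧ pmul e h = some y ∧ OmR x y) ∧
  (∃ x y, pmul g f = some x ∧ pmul h f = some y ∧ OmL x y)

/-- The sandwich set `S(e, f)`. -/
def Sandwich (e f : E) : Set E := {h | h ∈ MSet e f ∧ ∀ g ∈ MSet e f, SandwichLE e f g h}

end Basic

/-- Biordered sets (in the sense of Nambooripad).  Each axiom is followed by its left-right dual,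
marked `_dual`.  Under the hypotheses of each axiom, all products written in it are defined. -/
class BiorderedSet (E : Type*) extends PartialMagma E where
  omL_refl : ∀ e : E, OmL e e
  omL_trans : ∀ e f g : E, OmL e f → OmL f g → OmL e g
  omR_refl : ∀ e : E, OmR e e
  omR_trans : ∀ e f g : E, OmR e f → OmR f g → OmR e g
  /-- the domain of the product is `(ω^r ∪ ω^l) ∪ (ω^r ∪ ω^l)⁻¹` -/
  defined_iff : ∀ e f : E,
    (pmul e f).isSome ↔ (OmR e f ∨ OmL e f) ∨ (OmR f e ∨ OmL f e)
  /-- `f ω^r e ⇒ f R fe ω e` -/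
  b21 : ∀ e f : E, OmR f e → ∃ x, pmul f e = some x ∧ GreenR f x ∧ Om x e
  /-- `f ω^l e ⇒ f L ef ω e` -/
  b21_dual : ∀ e f : E, OmL f e → ∃ x, pmul e f = some x ∧ GreenL f x ∧ Om x e
  /-- `g ω^l f` and `f, g ∈ ω^r(e) ⇒ ge ω^l fe` -/
  b22 : ∀ e f g : E, OmL g f → OmR f e → OmR g e →
    ∃ x y, pmul g e = some x ∧ pmul f e = some y ∧ OmL x y
  /-- `g ω^r f` and `f, g ∈ ω^l(e) ⇒ eg ω^r ef` -/
  b22_dual : ∀ e f g : E, OmR g f → OmL f e → OmL g e →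
    ∃ x y, pmul e g = some x ∧ pmul e f = some y ∧ OmR x y
  /-- `g ω^r f ω^r e ⇒ gf = (ge)f` -/
  b31 : ∀ e f g : E, OmR g f → OmR f e →
    pmul g f = (pmul g e).bind fun x => pmul x f
  /-- `g ω^l f ω^l e ⇒ fg = f(eg)` -/
  b31_dual : ∀ e f g : E, OmL g f → OmL f e →
    pmul f g = (pmul e g).bind fun x => pmul f x
  /-- `g ω^l f` and `f, g ∈ ω^r(e) ⇒ (fg)e = (fe)(ge)` -/
  b32 : ∀ e f g : E, OmL g f → OmR f e → OmR g e →
    ((pmul f g).bind fun x => pmul x e) =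
      (pmul f e).bind fun x => (pmul g e).bind fun y => pmul x y
  /-- `g ω^r f` and `f, g ∈ ω^l(e) ⇒ e(gf) = (eg)(ef)` -/
  b32_dual : ∀ e f g : E, OmR g f → OmL f e → OmL g e →
    ((pmul g f).bind fun x => pmul e x) =
      (pmul e g).bind fun x => (pmul e f).bind fun y => pmul x y
  /-- `f, g ∈ ω^r(e) ⇒ S(f, g)e = S(fe, ge)` -/
  b4 : ∀ e f g : E, OmR f e → OmR g e →
    ∃ x y, pmul f e = some x ∧ pmul g e = some y ∧
      {k | ∃ h ∈ Sandwich f g, pmul h e = some k} = Sandwich x y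
  /-- `f, g ∈ ω^l(e) ⇒ eS(f, g) = S(ef, eg)` -/
  b4_dual : ∀ e f g : E, OmL f e → OmL g e →
    ∃ x y, pmul e f = some x ∧ pmul e g = some y ∧
      {k | ∃ h ∈ Sandwich f g, pmul e h = some k} = Sandwich x y

/-- Regular biordered sets: all sandwich sets are nonempty. -/
class RegularBiorderedSet (E : Type*) extends BiorderedSet E where
  sandwich_nonempty : ∀ e f : E, (Sandwich e f).Nonempty

section Quotients

variable (E : Type*) [BiorderedSet E]

/-- The equivalence relation `L` on a biordered set. -/
def leftSetoid : Setoid E where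
  r := GreenL
  iseqv :=
    { refl := fun e => ⟨BiorderedSet.omL_refl e, BiorderedSet.omL_refl e⟩
      symm := fun h => ⟨h.2, h.1⟩
      trans := fun h k => ⟨BiorderedSet.omL_trans _ _ _ h.1 k.1,
        BiorderedSet.omL_trans _ _ _ k.2 h.2⟩ }

/-- The equivalence relation `R` on a biordered set. -/
def rightSetoid : Setoid E where
  r := GreenR
  iseqv :=
    { refl := fun e => ⟨BiorderedSet.omR_refl e, BiorderedSet.omR_refl e⟩
      symm := fun h => ⟨h.2, h.1⟩
      trans := fun h k => ⟨BiorderedSet.omR_trans _ _ _ h.1 k.1,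
        BiorderedSet.omR_trans _ _ _ k.2 h.2⟩ }

/-- The quotient `E/L`. -/
def LeftQuot : Type _ := Quotient (leftSetoid E)

/-- The quotient `E/R`. -/
def RightQuot : Type _ := Quotient (rightSetoid E)

variable {E}

/-- The class `L(e)`. -/
def LeftQuot.mk (e : E) : LeftQuot E := Quotient.mk (leftSetoid E) e

/-- The class `R(e)`. -/
def RightQuot.mk (e : E) : RightQuot E := Quotient.mk (rightSetoid E) e

/-- `L(e) ≤ L(f)` if and only if `e ω^l f`. -/
instance : PartialOrder (LeftQuot E) where
  le := Quotient.lift₂ (s₁ := leftSetoid E) (s₂ := leftSetoid E) (fun e f => OmL e f)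
    (fun _ _ _ _ h k => propext
      ⟨fun t => BiorderedSet.omL_trans _ _ _ h.2 (BiorderedSet.omL_trans _ _ _ t k.1),
        fun t => BiorderedSet.omL_trans _ _ _ h.1 (BiorderedSet.omL_trans _ _ _ t k.2)⟩)
  le_refl a := Quotient.inductionOn a fun e => BiorderedSet.omL_refl e
  le_trans a b c := Quotient.inductionOn₃ a b c fun e f g => BiorderedSet.omL_trans e f g
  le_antisymm a b := Quotient.inductionOn₂ a b fun _ _ h k => Quotient.sound ⟨h, k⟩

/-- `R(e) ≤ R(f)` if and only if `e ω^r f`. -/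
instance : PartialOrder (RightQuot E) where
  le := Quotient.lift₂ (s₁ := rightSetoid E) (s₂ := rightSetoid E) (fun e f => OmR e f)
    (fun _ _ _ _ h k => propext
      ⟨fun t => BiorderedSet.omR_trans _ _ _ h.2 (BiorderedSet.omR_trans _ _ _ t k.1),
        fun t => BiorderedSet.omR_trans _ _ _ h.1 (BiorderedSet.omR_trans _ _ _ t k.2)⟩)
  le_refl a := Quotient.inductionOn a fun e => BiorderedSet.omR_refl e
  le_trans a b c := Quotient.inductionOn₃ a b c fun e f g => BiorderedSet.omR_trans e f g
  le_antisymm a b := Quotient.inductionOn₂ a b fun _ _ h k => Quotient.sound ⟨h, k⟩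

theorem LeftQuot.mk_le_mk {e f : E} : LeftQuot.mk e ≤ LeftQuot.mk f ↔ OmL e f := Iff.rfl

theorem RightQuot.mk_le_mk {e f : E} : RightQuot.mk e ≤ RightQuot.mk f ↔ OmR e f := Iff.rfl

end Quotients

/-- The given partial order on `P` is a complemented modular lattice: it is the order of a lattice
structure which is modular, has a least and a greatest element, and in which every element has
a complement. -/
def IsComplementedModularLattice (P : Type*) [inst : PartialOrder P] : Prop :=
  ∃ L : Lattice P, L.toPartialOrder = inst ∧ @IsModularLattice P L ∧
    ∃ B : @BoundedOrder P L.toPartialOrder.toLE, @ComplementedLattice P L B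

end Biorder

/-!
The model is the biordered set of idempotents of a von Neumann regular ring, with `e' = 1 - e`:
there `E/L` and `E/R` are the lattices of principal left and right ideals, `e ω^l f` says
`ef = e`, and `M(e, f) = {0}` says `ef = 0`. The argument is the usual one for these
lattices, with orthogonality `M(e, f) = {0}` replacing the equation `ef = 0`. Condition (E2) says
`f ω^l e' ↔ f ⊥ e ↔ e ω^r f'`, so each of the two preorders is determined by orthogonality, and
`e ↦ e'` induces the dual isomorphism `E/L ≃ (E/R)ᵒᵈ`. Axiom (B4) gives
`fe ⊥ ge ↔ f ⊥ g` for `f, g ω^r e`, with its dual (`perp_tmul_right`, `perp_tmul_left`); this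
replaces associativity.

*Meets.* For `k ω e` and `p ∈ S(e, k')` the element `pk'` is a meet of `e` and `k'` in `E/L`; in a
ring it generates the same left ideal as `e - k`. The general case reduces to this one: for
`h ∈ S(e, f')` the element `k = eh` satisfies `k ω e`, and below `e` the conditions `x ω^l f` and
`x ω^l k'` agree (`exists_omL_inf`). Meets in `E/R` are dual, and they give joins in `E/L`.

*Complements.* `L(e')` is a complement of `L(e)`.

*Modularity.* It suffices to exclude pentagons (`omL_of_pentagon`). Let `a ω^l c` have the same
meet and the same join with `b`, and let `h ∈ S(a, b')`. The equality of the joins makes `h` as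
good as a sandwich element of `c` and `b'`, so that `c ∧ b = c ∧ (ch)'`. By the equality of the
meets, `a` lies above `c ∧ (ch)'`; it also lies above `ch`, because `h ω^l a`. In a
ring `c = ch + (c - ch)` then lies in the left ideal of `a`; `omL_of_forall_omL` is this step for
biordered sets.
-/

namespace Biorder

/-! ### The basic products -/

section Products

variable {E : Type*} [BiorderedSet E]

/-- The partial product made total: `ef` where it is defined, and the junk value `e` elsewhere.
It is only used for products that are defined. -/
def tmul (e f : E) : E := (pmul e f).getD e

local infixl:70 " ⊙ " => tmul

theorem tmul_eq_of_pmul {e f x : E} (h : pmul e f = some x) : e ⊙ f = x := by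
  simp [tmul, h]

theorem OmL.refl (e : E) : OmL e e := BiorderedSet.omL_refl e

theorem OmR.refl (e : E) : OmR e e := BiorderedSet.omR_refl e

theorem OmL.trans {e f g : E} (h : OmL e f) (k : OmL f g) : OmL e g :=
  BiorderedSet.omL_trans e f g h k

theorem OmR.trans {e f g : E} (h : OmR e f) (k : OmR f g) : OmR e g :=
  BiorderedSet.omR_trans e f g h k

theorem OmL.tmul_eq {e f : E} (h : OmL e f) : e ⊙ f = e := tmul_eq_of_pmul h

theorem OmR.tmul_eq {e f : E} (h : OmR e f) : f ⊙ e = e := tmul_eq_of_pmul h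

theorem OmR.greenR_tmul {e f : E} (h : OmR f e) : GreenR f (f ⊙ e) := by
  obtain ⟨x, hx, hR, -⟩ := BiorderedSet.b21 e f h
  rwa [tmul_eq_of_pmul hx]

theorem OmR.tmul_om {e f : E} (h : OmR f e) : Om (f ⊙ e) e := by
  obtain ⟨x, hx, -, ho⟩ := BiorderedSet.b21 e f h
  rwa [tmul_eq_of_pmul hx]

theorem OmL.greenL_tmul {e f : E} (h : OmL f e) : GreenL f (e ⊙ f) := by
  obtain ⟨x, hx, hL, -⟩ := BiorderedSet.b21_dual e f h
  rwa [tmul_eq_of_pmul hx]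

theorem OmL.tmul_om {e f : E} (h : OmL f e) : Om (e ⊙ f) e := by
  obtain ⟨x, hx, -, ho⟩ := BiorderedSet.b21_dual e f h
  rwa [tmul_eq_of_pmul hx]

theorem omR_tmul_of_mem_sandwich {e f g h : E} (hh : h ∈ Sandwich e f)
    (hl : OmL g e) (hr : OmR g f) : OmR (e ⊙ g) (e ⊙ h) := by
  obtain ⟨⟨x, y, hx, hy, H⟩, -⟩ := hh.2 g ⟨hl, hr⟩
  rwa [tmul_eq_of_pmul hx, tmul_eq_of_pmul hy]

theorem omL_tmul_of_mem_sandwich {e f g h : E} (hh : h ∈ Sandwich e f)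
    (hl : OmL g e) (hr : OmR g f) : OmL (g ⊙ f) (h ⊙ f) := by
  obtain ⟨-, ⟨x, y, hx, hy, H⟩⟩ := hh.2 g ⟨hl, hr⟩
  rwa [tmul_eq_of_pmul hx, tmul_eq_of_pmul hy]

theorem tmul_right_mem_sandwich {e f g h : E} (hf : OmR f e) (hg : OmR g e)
    (hh : h ∈ Sandwich f g) : h ⊙ e ∈ Sandwich (f ⊙ e) (g ⊙ e) := by
  obtain ⟨x, y, hx, hy, H⟩ := BiorderedSet.b4 e f g hf hg
  rw [tmul_eq_of_pmul hx, tmul_eq_of_pmul hy, ← H]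
  obtain ⟨z, hz, -⟩ := BiorderedSet.b21 e h (hh.1.2.trans hg)
  exact ⟨h, hh, by rw [tmul_eq_of_pmul hz, hz]⟩

theorem exists_mem_sandwich_tmul_right_eq {e f g k : E} (hf : OmR f e) (hg : OmR g e)
    (hk : k ∈ Sandwich (f ⊙ e) (g ⊙ e)) : ∃ h ∈ Sandwich f g, h ⊙ e = k := by
  obtain ⟨x, y, hx, hy, H⟩ := BiorderedSet.b4 e f g hf hg
  rw [tmul_eq_of_pmul hx, tmul_eq_of_pmul hy, ← H] at hk
  obtain ⟨h, hh, hhk⟩ := hk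
  exact ⟨h, hh, tmul_eq_of_pmul hhk⟩

theorem tmul_left_mem_sandwich {e f g h : E} (hf : OmL f e) (hg : OmL g e)
    (hh : h ∈ Sandwich f g) : e ⊙ h ∈ Sandwich (e ⊙ f) (e ⊙ g) := by
  obtain ⟨x, y, hx, hy, H⟩ := BiorderedSet.b4_dual e f g hf hg
  rw [tmul_eq_of_pmul hx, tmul_eq_of_pmul hy, ← H]
  obtain ⟨z, hz, -⟩ := BiorderedSet.b21_dual e h (hh.1.1.trans hf)
  exact ⟨h, hh, by rw [tmul_eq_of_pmul hz, hz]⟩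

/-- If `u ω^l g`, then `gu`, the projection of `u` into `ω(g)`, lies in `S(u, g)`. -/
theorem OmL.tmul_mem_sandwich {u g : E} (h : OmL u g) : g ⊙ u ∈ Sandwich u g := by
  have hL := h.greenL_tmul
  have ho := h.tmul_om
  refine ⟨⟨hL.2, ho.2⟩, fun r hr => ⟨?_, ?_⟩⟩
  · obtain ⟨x, hx, -, hxo⟩ := BiorderedSet.b21_dual u r hr.1
    exact ⟨x, u, hx, hL.1, hxo.2⟩
  · exact ⟨r, g ⊙ u, hr.1.trans h, ho.1, hr.1.trans hL.1⟩

end Products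

/-! ### Orthogonality -/

/-- A zero element together with a complementation: the data of conditions (E1) and (E2). -/
structure Complementation (E : Type*) [RegularBiorderedSet E] where
  /-- the zero element -/
  zero : E
  zero_om : ∀ e : E, Om zero e
  /-- the complementation `e ↦ e'` -/
  compl : E → E
  compl_compl : ∀ e : E, compl (compl e) = e
  omL_iff : ∀ e f : E, OmL f e ↔ OmR (compl e) (compl f)
  omL_compl_iff : ∀ e f : E, OmL f (compl e) ↔ MSet f e = {zero}

namespace Complementation

variable {E : Type*} [RegularBiorderedSet E] (C : Complementation E)

local infixl:70 " ⊙ " => tmul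

/-- Orthogonality `M(e, f) = {0}`. For the idempotents of a regular ring it says `ef = 0`. -/
def Perp (e f : E) : Prop := ∀ g, OmL g e → OmR g f → g = C.zero

theorem eq_zero_of_omL {g : E} (h : OmL g C.zero) : g = C.zero :=
  Option.some.inj (h.symm.trans (C.zero_om g).2)

theorem eq_zero_of_omR {g : E} (h : OmR g C.zero) : g = C.zero :=
  Option.some.inj (h.symm.trans (C.zero_om g).1)

theorem eq_zero_of_tmul_right {e g : E} (hg : OmR g e) (h : g ⊙ e = C.zero) : g = C.zero :=
  C.eq_zero_of_omR (h ▸ hg.greenR_tmul.1)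

theorem eq_zero_of_tmul_left {e g : E} (hg : OmL g e) (h : e ⊙ g = C.zero) : g = C.zero :=
  C.eq_zero_of_omL (h ▸ hg.greenL_tmul.1)

theorem perp_iff_omL {e f : E} : C.Perp f e ↔ OmL f (C.compl e) := by
  rw [C.omL_compl_iff]
  constructor
  · intro h
    ext g
    constructor
    · exact fun hg => h g hg.1 hg.2
    · rintro rfl
      exact ⟨(C.zero_om f).1, (C.zero_om e).2⟩
  · intro h g h1 h2
    have : g ∈ MSet f e := ⟨h1, h2⟩
    rwa [h] at this

theorem perp_iff_omR {e f : E} : C.Perp f e ↔ OmR e (C.compl f) := by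
  rw [C.perp_iff_omL, C.omL_iff, C.compl_compl]

theorem omL_iff_perp {e f : E} : OmL f e ↔ C.Perp f (C.compl e) := by
  rw [C.perp_iff_omL, C.compl_compl]

theorem omR_iff {e f : E} : OmR f e ↔ OmL (C.compl e) (C.compl f) := by
  rw [C.omL_iff, C.compl_compl, C.compl_compl]

theorem Perp.mono {C : Complementation E} {a b c d : E} (h : C.Perp b d) (hl : OmL a b)
    (hr : OmR c d) : C.Perp a c :=
  fun g h1 h2 => h g (h1.trans hl) (h2.trans hr)

theorem eq_zero_of_perp_of_mem {e f h : E} (H : C.Perp e f) (hh : h ∈ Sandwich e f) :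
    h = C.zero :=
  H h hh.1.1 hh.1.2

theorem perp_of_zero_mem_sandwich {e f : E} (h : C.zero ∈ Sandwich e f) : C.Perp e f := by
  intro g h1 h2
  have := omR_tmul_of_mem_sandwich h h1 h2
  rw [(C.zero_om e).2.tmul_eq] at this
  exact C.eq_zero_of_tmul_left h1 (C.eq_zero_of_omR this)

theorem perp_tmul_right {e f g : E} (hf : OmR f e) (hg : OmR g e) :
    C.Perp (f ⊙ e) (g ⊙ e) ↔ C.Perp f g := by
  obtain ⟨h, hh⟩ := RegularBiorderedSet.sandwich_nonempty f g
  have hm := tmul_right_mem_sandwich hf hg hh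
  constructor
  · intro H
    have h0 := C.eq_zero_of_tmul_right (hh.1.2.trans hg) (C.eq_zero_of_perp_of_mem H hm)
    exact C.perp_of_zero_mem_sandwich (h0 ▸ hh)
  · intro H
    rw [C.eq_zero_of_perp_of_mem H hh, (C.zero_om e).1.tmul_eq] at hm
    exact C.perp_of_zero_mem_sandwich hm

theorem perp_tmul_left {e f g : E} (hf : OmL f e) (hg : OmL g e) :
    C.Perp (e ⊙ f) (e ⊙ g) ↔ C.Perp f g := by
  obtain ⟨h, hh⟩ := RegularBiorderedSet.sandwich_nonempty f g
  have hm := tmul_left_mem_sandwich hf hg hh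
  constructor
  · intro H
    have h0 := C.eq_zero_of_tmul_left (hh.1.1.trans hf) (C.eq_zero_of_perp_of_mem H hm)
    exact C.perp_of_zero_mem_sandwich (h0 ▸ hh)
  · intro H
    rw [C.eq_zero_of_perp_of_mem H hh, (C.zero_om e).2.tmul_eq] at hm
    exact C.perp_of_zero_mem_sandwich hm

/-- In a ring: if `x = xe` and `h = he`, then `x(eh) = xh`. -/
theorem perp_tmul_iff_of_omL {e x h : E} (hx : OmL x e) (hh : OmL h e) :
    C.Perp x (e ⊙ h) ↔ C.Perp x h := by
  rw [← C.perp_tmul_left hx hh]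
  exact ⟨fun H => H.mono hx.greenL_tmul.2 (.refl _), fun H => H.mono hx.greenL_tmul.1 (.refl _)⟩

/-- In a ring: if `y = ey` and `h = eh`, then `(he)y = hy`. -/
theorem tmul_perp_iff_of_omR {e y h : E} (hy : OmR y e) (hh : OmR h e) :
    C.Perp (h ⊙ e) y ↔ C.Perp h y := by
  rw [← C.perp_tmul_right hh hy]
  exact ⟨fun H => H.mono (.refl _) hy.greenR_tmul.2, fun H => H.mono (.refl _) hy.greenR_tmul.1⟩

/-! ### Meets and joins -/

/-- For `h ∈ S(e, f)` and `x ω^l e`, orthogonality of `x` to `f` is orthogonality to `eh`: in a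
ring, `xf = xef = x(eh)f`. -/
theorem perp_iff_perp_tmul_left {e f h x : E} (hh : h ∈ Sandwich e f) (hx : OmL x e) :
    C.Perp x f ↔ C.Perp x (e ⊙ h) := by
  constructor
  · intro H
    exact (C.perp_tmul_iff_of_omL hx hh.1.1).2 (H.mono (.refl _) hh.1.2)
  · intro H g h1 h2
    have hge := h1.trans hx
    exact C.eq_zero_of_tmul_left hge
      (H _ (hge.greenL_tmul.2.trans h1) (omR_tmul_of_mem_sandwich hh hge h2))

/-- The left-right dual of `perp_iff_perp_tmul_left`. -/
theorem perp_iff_tmul_right_perp {e f h y : E} (hh : h ∈ Sandwich e f) (hy : OmR y f) :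
    C.Perp e y ↔ C.Perp (h ⊙ f) y := by
  constructor
  · intro H
    exact (C.tmul_perp_iff_of_omR hy hh.1.2).2 (H.mono hh.1.1 (.refl _))
  · intro H g h1 h2
    have hgf := h2.trans hy
    exact C.eq_zero_of_tmul_right hgf
      (H _ (omL_tmul_of_mem_sandwich hh h1 hgf) (hgf.greenR_tmul.2.trans h2))

/-- If `k ω e` and `p ∈ S(e, k')`, then `pk'` is a lower bound of `e` and `k'` for `ω^l`. -/
theorem tmul_compl_omL {e k p : E} (hk : Om k e) (hp : p ∈ Sandwich e (C.compl k)) :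
    OmL (p ⊙ C.compl k) e := by
  have he : OmR (C.compl e) (C.compl k) := (C.omL_iff _ _).1 hk.1
  rw [C.omL_iff_perp, C.tmul_perp_iff_of_omR he hp.1.2, ← C.omL_iff_perp]
  exact hp.1.1

/-- If `k ω e` and `p ∈ S(e, k')`, then `ep` is a lower bound of `e` and `k'` for `ω^r`. -/
theorem tmul_omR_compl {e k p : E} (hk : Om k e) (hp : p ∈ Sandwich e (C.compl k)) :
    OmR (e ⊙ p) (C.compl k) := by
  rw [← C.perp_iff_omR, C.perp_tmul_iff_of_omL hk.1 hp.1.1, C.perp_iff_omR]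
  exact hp.1.2

/-- Any two elements have a greatest lower bound for the preorder `ω^l`. -/
theorem exists_omL_inf (C : Complementation E) (e f : E) :
    ∃ m, OmL m e ∧ OmL m f ∧ ∀ x, OmL x e → OmL x f → OmL x m := by
  obtain ⟨h, hh⟩ := RegularBiorderedSet.sandwich_nonempty e (C.compl f)
  -- Below `e`, the conditions `x ω^l f` and `x ω^l (eh)'` agree, and `eh ω e`.
  have key : ∀ x, OmL x e → (OmL x f ↔ OmL x (C.compl (e ⊙ h))) := fun x hx => by
    rw [C.omL_iff_perp, ← C.perp_iff_omL, C.perp_iff_perp_tmul_left hh hx]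
  have hk : Om (e ⊙ h) e := hh.1.1.tmul_om
  obtain ⟨p, hp⟩ := RegularBiorderedSet.sandwich_nonempty e (C.compl (e ⊙ h))
  have hm := C.tmul_compl_omL hk hp
  refine ⟨p ⊙ (C.compl (e ⊙ h)), hm, (key _ hm).2 hp.1.2.tmul_om.1, fun x hx hxf => ?_⟩
  have hxk := (key x hx).1 hxf
  have hL := hxk.greenL_tmul
  have ho := hxk.tmul_om
  have := omL_tmul_of_mem_sandwich hp (hL.2.trans hx) ho.2
  rw [ho.1.tmul_eq] at this
  exact hL.1.trans this

/-- Any two elements have a greatest lower bound for the preorder `ω^r`. -/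
theorem exists_omR_inf (C : Complementation E) (e f : E) :
    ∃ m, OmR m e ∧ OmR m f ∧ ∀ x, OmR x e → OmR x f → OmR x m := by
  obtain ⟨h, hh⟩ := RegularBiorderedSet.sandwich_nonempty (C.compl f) e
  have key : ∀ x, OmR x e → (OmR x f ↔ OmR x (C.compl (h ⊙ e))) := fun x hx => by
    rw [← C.perp_iff_omR, ← C.perp_iff_tmul_right_perp hh hx, C.perp_iff_omR, C.compl_compl]
  have hk : Om (h ⊙ e) e := hh.1.2.tmul_om
  obtain ⟨p, hp⟩ := RegularBiorderedSet.sandwich_nonempty e (C.compl (h ⊙ e))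
  have hm : OmR (e ⊙ p) e := hp.1.1.tmul_om.2
  refine ⟨e ⊙ p, hm, (key _ hm).2 (C.tmul_omR_compl hk hp), fun x hx hxf => ?_⟩
  have hR := hx.greenR_tmul
  have ho := hx.tmul_om
  have := omR_tmul_of_mem_sandwich hp ho.1 (hR.2.trans ((key x hx).1 hxf))
  rw [ho.2.tmul_eq] at this
  exact hR.1.trans this

/-- Any two elements have a least upper bound for `ω^l`: complementation turns it into a greatest
lower bound for `ω^r`. -/
theorem exists_omL_sup (C : Complementation E) (e f : E) :
    ∃ m, OmL e m ∧ OmL f m ∧ ∀ x, OmL e x → OmL f x → OmL m x := by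
  obtain ⟨m, h1, h2, h3⟩ := C.exists_omR_inf (C.compl e) (C.compl f)
  simp only [C.omR_iff, C.compl_compl] at h1 h2 h3
  refine ⟨(C.compl m), h1, h2, fun x hx hy => ?_⟩
  have := h3 (C.compl x)
  simp only [C.compl_compl] at this
  exact this hx hy

theorem eq_zero_of_omL_of_omL_compl {e x : E} (h : OmL x e) (h' : OmL x (C.compl e)) : x = C.zero :=
  C.eq_zero_of_tmul_left h (C.perp_iff_omL.2 h' _ h.greenL_tmul.2 h.tmul_om.2)

theorem eq_zero_of_omR_of_omR_compl {e x : E} (h : OmR x e) (h' : OmR x (C.compl e)) : x = C.zero :=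
  C.eq_zero_of_tmul_right h (C.perp_iff_omR.2 h' _ h.tmul_om.1 h.greenR_tmul.2)

theorem omL_compl_zero (e : E) : OmL e (C.compl C.zero) := by
  rw [C.omL_iff, C.compl_compl]
  exact (C.zero_om _).2

theorem eq_compl_zero_of_omL_of_compl_omL {e x : E} (h : OmL e x) (h' : OmL (C.compl e) x) :
    x = C.compl C.zero := by
  rw [C.omL_iff] at h h'
  rw [C.compl_compl] at h'
  rw [← C.eq_zero_of_omR_of_omR_compl h' h, C.compl_compl]

/-! ### Modularity -/

/-- If `x ⊥ h`, then no nonzero `u` below `x` satisfies `uf ω^l hf`: axiom (B4) lifts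
`(hf)(uf) ∈ S(uf, hf)` to an element of `S(u, h)`, and `S(u, h) = {0}`. -/
theorem eq_zero_of_tmul_omL {x f h u : E} (hh : OmR h f) (hxh : C.Perp x h) (hux : OmL u x)
    (huf : OmR u f) (H : OmL (u ⊙ f) (h ⊙ f)) : u = C.zero := by
  obtain ⟨v, hv, hvw⟩ := exists_mem_sandwich_tmul_right_eq huf hh H.tmul_mem_sandwich
  have hv0 : v = C.zero := hxh v (hv.1.1.trans hux) hv.1.2
  rw [hv0, (C.zero_om f).1.tmul_eq] at hvw
  exact C.eq_zero_of_tmul_right huf (C.eq_zero_of_tmul_left H hvw.symm)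

/-- Let `k, l ω e`. If every common `ω^r`-lower bound of `e` and `k'` is orthogonal to `l`, then
`l ω^l k`. In a ring: `l(e - k) = 0` gives `l = lk`. -/
theorem omL_of_forall_perp {e k l : E} (hk : Om k e) (hl : OmL l e)
    (H : ∀ y, OmR y e → OmR y (C.compl k) → C.Perp l y) : OmL l k := by
  obtain ⟨p, hp⟩ := RegularBiorderedSet.sandwich_nonempty e (C.compl k)
  have hq := H (e ⊙ p) hp.1.1.tmul_om.2 (C.tmul_omR_compl hk hp)
  rw [C.omL_iff_perp]
  intro z h1 h2
  have hze := h1.trans hl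
  exact C.eq_zero_of_tmul_left hze
    (hq _ (hze.greenL_tmul.2.trans h1) (omR_tmul_of_mem_sandwich hp hze h2))

/-- If `k ω c` and `a` is above `k` and above all common `ω^l`-lower bounds of `c` and `k'`, then
`a` is above `c`. In a ring: `c = k + (c - k)`. -/
theorem omL_of_forall_omL {a c k : E} (hk : Om k c) (hka : OmL k a)
    (H : ∀ x, OmL x c → OmL x (C.compl k) → OmL x a) : OmL c a := by
  obtain ⟨p, hp⟩ := RegularBiorderedSet.sandwich_nonempty c (C.compl k)
  have hm := H (p ⊙ C.compl k) (C.tmul_compl_omL hk hp) hp.1.2.tmul_om.1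
  rw [C.omL_iff_perp] at hm ⊢
  intro z h1 h2
  have hzk : OmR z (C.compl k) := h2.trans ((C.omL_iff _ _).1 hka)
  exact C.eq_zero_of_tmul_right hzk
    (hm _ (omL_tmul_of_mem_sandwich hp h1 hzk) (hzk.greenR_tmul.2.trans h2))

/-- `E/L` has no pentagon: if `a ω^l c`, every common lower bound of `c` and `b` is below `a`, and
every common upper bound of `a` and `b` is above `c`, then `c ω^l a`. -/
theorem omL_of_pentagon (C : Complementation E) {a b c : E} (hac : OmL a c)
    (hinf : ∀ x, OmL x c → OmL x b → OmL x a)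
    (hsup : ∀ x, OmL a x → OmL b x → OmL c x) : OmL c a := by
  obtain ⟨h, hh⟩ := RegularBiorderedSet.sandwich_nonempty a (C.compl b)
  obtain ⟨g, hg⟩ := RegularBiorderedSet.sandwich_nonempty c (C.compl b)
  have hhc : OmL h c := hh.1.1.trans hac
  -- In a ring, `h` is a sandwich element of `c` and `b'` too; all that is needed of this is
  -- that `gb'` is in the left ideal of `hb'`.
  have hgh : OmL (g ⊙ C.compl b) (h ⊙ C.compl b) := by
    refine C.omL_of_forall_perp hh.1.2.tmul_om hg.1.2.tmul_om.1 fun y hyb hyk => ?_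
    rw [← C.perp_iff_tmul_right_perp hg hyb]
    rw [← C.perp_iff_omR, ← C.perp_iff_tmul_right_perp hh hyb] at hyk
    rw [← C.perp_iff_omR] at hyb
    rw [C.perp_iff_omL] at hyk hyb ⊢
    exact hsup _ hyk hyb
  refine C.omL_of_forall_omL hhc.tmul_om (hhc.greenL_tmul.2.trans hh.1.1) fun x hxc hxk => ?_
  rw [← C.perp_iff_omL, C.perp_tmul_iff_of_omL hxc hhc] at hxk
  refine hinf x hxc (C.omL_iff_perp.2 fun u hux hub => ?_)
  exact C.eq_zero_of_tmul_omL hh.1.2 hxk hux hub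
    ((omL_tmul_of_mem_sandwich hg (hux.trans hxc) hub).trans hgh)

end Complementation

/-! ### Order-theoretic lemmas -/

/-- A bounded partial order with binary meets and joins and with complements is a complemented
modular lattice as soon as it contains no pentagon. -/
theorem isComplementedModularLattice_of_no_pentagon {P : Type*} [PartialOrder P] {bot top : P}
    (hbot : ∀ a, bot ≤ a) (htop : ∀ a, a ≤ top)
    (hinf : ∀ a b : P, ∃ m, m ≤ a ∧ m ≤ b ∧ ∀ x, x ≤ a → x ≤ b → x ≤ m)
    (hsup : ∀ a b : P, ∃ m, a ≤ m ∧ b ≤ m ∧ ∀ x, a ≤ x → b ≤ x → m ≤ x)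
    (hcompl : ∀ a : P, ∃ b, (∀ x, x ≤ a → x ≤ b → x = bot) ∧
      ∀ x, a ≤ x → b ≤ x → x = top)
    (hpent : ∀ a b c : P, a ≤ c → (∀ x, x ≤ c → x ≤ b → x ≤ a) →
      (∀ x, a ≤ x → b ≤ x → c ≤ x) → c ≤ a) :
    IsComplementedModularLattice P := by
  choose inf inf_left inf_right le_inf using hinf
  choose sup left_sup right_sup sup_le using hsup
  let L : Lattice P :=
    { (inferInstance : PartialOrder P) with
      inf := inf
      inf_le_left := inf_left
      inf_le_right := inf_right
      le_inf := fun a b c h k => le_inf b c a h k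
      sup := sup
      le_sup_left := left_sup
      le_sup_right := right_sup
      sup_le := fun a b c h k => sup_le a b c h k }
  let B : BoundedOrder P := { bot := bot, top := top, bot_le := hbot, le_top := htop }
  refine ⟨L, rfl, ⟨fun {x} y {z} hxz => ?_⟩, B, ⟨fun a => ?_⟩⟩
  · -- The pentagon consists of `x ⊔ y ⊓ z`, `(x ⊔ y) ⊓ z` and `y`.
    refine hpent (x ⊔ y ⊓ z) y ((x ⊔ y) ⊓ z) ?_ (fun w h k => ?_) (fun w h k => ?_)
    · exact _root_.sup_le (_root_.le_inf le_sup_left hxz)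
        (_root_.le_inf (inf_le_left.trans le_sup_right) inf_le_right)
    · exact (_root_.le_inf k (h.trans inf_le_right)).trans le_sup_right
    · exact inf_le_left.trans (_root_.sup_le (le_sup_left.trans h) k)
  · obtain ⟨b, h1, h2⟩ := hcompl a
    exact ⟨b, isCompl_iff.2 ⟨disjoint_iff.2 (h1 _ inf_le_left inf_le_right),
      codisjoint_iff.2 (h2 _ le_sup_left le_sup_right)⟩⟩

/-- A partial order dually isomorphic to a complemented modular lattice is one itself. -/
theorem IsComplementedModularLattice.of_dual {P Q : Type*} [iP : PartialOrder P]
    [iQ : PartialOrder Q] (φ : P ≃o Qᵒᵈ) (h : IsComplementedModularLattice P) :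
    IsComplementedModularLattice Q := by
  obtain ⟨L, rfl, hM, B, hC⟩ := h
  let ψ : Q ≃o Pᵒᵈ := φ.dual.symm
  let L' : Lattice Q :=
    { iQ with
      inf := fun x y => ψ.symm (ψ x ⊓ ψ y)
      inf_le_left := fun x y => ψ.symm_apply_le.2 inf_le_left
      inf_le_right := fun x y => ψ.symm_apply_le.2 inf_le_right
      le_inf := fun x y z h k => ψ.le_symm_apply.2 (le_inf (ψ.monotone h) (ψ.monotone k))
      sup := fun x y => ψ.symm (ψ x ⊔ ψ y)
      le_sup_left := fun x y => ψ.le_symm_apply.2 le_sup_left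
      le_sup_right := fun x y => ψ.le_symm_apply.2 le_sup_right
      sup_le := fun x y z h k => ψ.symm_apply_le.2 (sup_le (ψ.monotone h) (ψ.monotone k)) }
  let B' : BoundedOrder Q :=
    { bot := ψ.symm ⊥
      top := ψ.symm ⊤
      bot_le := fun _ => ψ.symm_apply_le.2 bot_le
      le_top := fun _ => ψ.le_symm_apply.2 le_top }
  refine ⟨L', rfl, ⟨fun {x} y {z} hxz => ?_⟩, B', ψ.symm.complementedLattice⟩
  rw [← ψ.le_iff_le]
  simpa only [map_sup, map_inf] using sup_inf_le_assoc_of_le (ψ y) (ψ.monotone hxz)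

end Biorder

open Biorder in
theorem corollary3p4 {E : Type*} [RegularBiorderedSet E]
    (zero : E) (hzero : ∀ e : E, Om zero e)
    (compl : E → E)
    (hinvol : ∀ e : E, compl (compl e) = e)
    (hdual : ∀ e f : E, OmL f e ↔ OmR (compl e) (compl f))
    (hann : ∀ e f : E, OmL f (compl e) ↔ MSet f e = {zero}) :
    IsComplementedModularLattice (LeftQuot E) ∧
    IsComplementedModularLattice (RightQuot E) ∧
    Nonempty (LeftQuot E ≃o (RightQuot E)ᵒᵈ) := by
  let C : Complementation E := ⟨zero, hzero, compl, hinvol, hdual, hann⟩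
  have hL : IsComplementedModularLattice (LeftQuot E) := by
    refine isComplementedModularLattice_of_no_pentagon
      (bot := LeftQuot.mk C.zero) (top := LeftQuot.mk (C.compl C.zero)) ?_ ?_ ?_ ?_ ?_ ?_
    · rintro ⟨e⟩
      exact (C.zero_om e).1
    · rintro ⟨e⟩
      exact C.omL_compl_zero e
    · rintro ⟨e⟩ ⟨f⟩
      obtain ⟨m, h1, h2, h3⟩ := C.exists_omL_inf e f
      exact ⟨LeftQuot.mk m, h1, h2, by rintro ⟨x⟩; exact h3 x⟩
    · rintro ⟨e⟩ ⟨f⟩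
      obtain ⟨m, h1, h2, h3⟩ := C.exists_omL_sup e f
      exact ⟨LeftQuot.mk m, h1, h2, by rintro ⟨x⟩; exact h3 x⟩
    · rintro ⟨e⟩
      refine ⟨LeftQuot.mk (C.compl e), ?_, ?_⟩
      · rintro ⟨x⟩ h k
        exact congrArg LeftQuot.mk (C.eq_zero_of_omL_of_omL_compl h k)
      · rintro ⟨x⟩ h k
        exact congrArg LeftQuot.mk (C.eq_compl_zero_of_omL_of_compl_omL h k)
    · rintro ⟨a⟩ ⟨b⟩ ⟨c⟩ hac h k
      exact C.omL_of_pentagon hac (fun x => h (LeftQuot.mk x)) (fun x => k (LeftQuot.mk x))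
  let φ : LeftQuot E ≃o (RightQuot E)ᵒᵈ :=
    { toFun := Quotient.lift (s := leftSetoid E)
        (fun e => OrderDual.toDual (RightQuot.mk (C.compl e)))
        (fun e f h => Quotient.sound (s := rightSetoid E)
          ⟨(C.omL_iff _ _).1 h.2, (C.omL_iff _ _).1 h.1⟩)
      invFun := Quotient.lift (s := rightSetoid E) (fun e => LeftQuot.mk (C.compl e))
        (fun e f h => Quotient.sound (s := leftSetoid E)
          ⟨C.omR_iff.1 h.2, C.omR_iff.1 h.1⟩)
      left_inv := by
        rintro ⟨e⟩
        exact congrArg LeftQuot.mk (C.compl_compl e)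
      right_inv := by
        rintro ⟨e⟩
        exact congrArg RightQuot.mk (C.compl_compl e)
      map_rel_iff' := by
        rintro ⟨e⟩ ⟨f⟩
        exact (C.omL_iff f e).symm }
  exact ⟨hL, hL.of_dual φ, ⟨φ⟩⟩
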